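/- Let $n\in\mathbb{N}$, let $M$ be the set of all Lebesgue measurable functions $f:\mathbb{R}^n\to[0,1]$ (functions, not classes modulo null sets) with the supremum metric $d_\infty$, let $K:\mathbb{R}^n\to\mathbb{R}$ be in $L^1$ and let $G:\mathbb{R}\to\mathbb{R}$ be bounded and Lipschitz. The Lenia arc field is the map $X:M\times[0,1]\to M$, $$X_t(f)(x)=\bigl[f(x)+t\,G\bigl((K*f)(x)\bigr)\bigr]_0^1,\qquad (K*f)(x)=\int_{\mathbb{R}^n}K(x-y)f(y)\,dy,\qquad [u]_0^1=\max\{0,\min\{1,u\}\}.$$ In general, an arc field on a metric space $N$ is a continuous map $Y:N\times[0,1]\to N$ with $Y_0(f)=f$ for all $f$. A flow of $Y$ is a continuous map $F:N\times[0,\infty)\to N$ with $F_0(f)=f$, $F_t(F_s(f))=F_{s+t}(f)$ and $\lim_{h\to0^+}d(F_{t+h}(f),Y_h(F_t(f)))/h=0$ for all $f\in N$ and $s,t\ge 0$. **Proposition (continuity is preserved).** $X$ is an arc field on $M$. It has exactly one flow $F$, and $F_t(f)=\lim_{k\to\infty}X_{t/k}^{(k)}(f)$ in $d_\infty$ for all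 $f\in M$ and $t\ge0$, where $X_{t/k}^{(k)}$ is the $k$-fold composition of $X_{t/k}$ (defined for $k\ge \max\{t,1\}$). If $f_0\in M$ is continuous, then the Lenia solution $f_t:=F_t(f_0)$ is continuous for all $t>0$. Moreover, the set $C(\mathbb{R}^n,[0,1])$ of continuous functions is closed in $M$; $X$ maps $C(\mathbb{R}^n,[0,1])\times[0,1]$ into $C(\mathbb{R}^n,[0,1])$ and restricts to an arc field on it; and if $f_0\in C(\mathbb{R}^n,[0,1])$, $t\ge0$ and the Euler approximations $X_{t/k}^{(k)}(f_0)$ converge in $M$ to some $g$ as $k\to\infty$, then $g\in C(\mathbb{R}^n,[0,1])$. -/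

import Mathlib

open MeasureTheory Filter Topology
open scoped NNReal unitInterval

namespace Lenia

section ArcFields

/-- An arc field on a metric space: a (jointly) continuous map `X : M × [0,1] → M`
with `X₀(f) = f`. -/
structure IsArcField {M : Type*} [MetricSpace M] (X : M → I → M) : Prop where
  continuous : Continuous (fun p : M × I => X p.1 p.2)
  zero : ∀ f, X f 0 = f

/-- A forward flow on a metric space: a (jointly) continuous map `F : M × [0,∞) → M` with
`F₀(f) = f` and `F_t(F_s(f)) = F_{s+t}(f)`. -/
structure IsFlow {M : Type*} [MetricSpace M] (F : M → ℝ≥0 → M) : Prop where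
  continuous : Continuous (fun p : M × ℝ≥0 => F p.1 p.2)
  zero : ∀ f, F f 0 = f
  add : ∀ f s t, F (F f s) t = F f (s + t)

/-- `F` is a flow of the arc field `X`: a forward flow that is forward tangent to `X`,
i.e. `d(F_{t+h}(f), X_h(F_t(f))) / h → 0` as `h → 0⁺`, for all `t ≥ 0` and all `f`. -/
structure IsFlowOf {M : Type*} [MetricSpace M] (X : M → I → M) (F : M → ℝ≥0 → M) : Prop
    extends IsFlow F where
  tangent : ∀ f t, Tendsto
    (fun h : I => dist (F f (t + unitInterval.toNNReal h)) (X (F f t) h) / (h : ℝ))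
    (𝓝[>] 0) (𝓝 0)

/-- The Euler approximation `X_{t/n}^{(n)}(f)`: the `n`-fold composition of `X_{t/n}`, applied
to `f`. The step `t/n` lies in `[0,1]` as soon as `n ≥ t` (for the finitely many smaller `n` it is
truncated to `1`, which is irrelevant to the limit `n → ∞`). -/
noncomputable def euler {M : Type*} (X : M → I → M) (t : ℝ≥0) (n : ℕ) (f : M) : M :=
  (fun g => X g (Set.projIcc 0 1 zero_le_one ((t : ℝ) / n)))^[n] f

/-- The arc field `X` restricts to the subset `C` of `M`: it maps `C × [0,1]` into `C`, and the
resulting map is an arc field on `C`. -/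
def RestrictsTo {M : Type*} [MetricSpace M] (X : M → I → M) (C : Set M) : Prop :=
  ∃ Y : C → I → C, IsArcField Y ∧ ∀ (f : C) (t : I), (Y f t : M) = X f t

end ArcFields

/-- The state space `M = 𝓑(ℝⁿ, [0,1])`: all Lebesgue measurable functions `ℝⁿ → [0,1]` (functions,
not classes modulo null sets). As a subtype of `UniformFun` it carries the supremum metric. -/
abbrev State (n : ℕ) : Type :=
  {f : UniformFun (EuclideanSpace ℝ (Fin n)) I // NullMeasurable (UniformFun.toFun f) volume}

namespace State

variable {n : ℕ}

/-- The underlying function `ℝⁿ → [0,1]` of a state. -/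
def fn (f : State n) : EuclideanSpace ℝ (Fin n) → I := UniformFun.toFun f.1

/-- The metric of `State n` is the supremum metric. -/
theorem dist_eq (f g : State n) : dist f g = ⨆ x, |(f.fn x : ℝ) - (g.fn x : ℝ)| := rfl

end State

/-- The convolution `(K ∗ f)(x) = ∫ K(x - y) f(y) dy`. -/
noncomputable def conv {n : ℕ} (K : EuclideanSpace ℝ (Fin n) → ℝ) (f : State n)
    (x : EuclideanSpace ℝ (Fin n)) : ℝ :=
  ∫ y, K (x - y) * (f.fn y : ℝ)

theorem aemeasurable_fn {n : ℕ} (f : State n) :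
    AEMeasurable (fun y => (f.fn y : ℝ)) volume :=
  measurable_subtype_coe.comp_aemeasurable (NullMeasurable.aemeasurable f.2)

theorem measurable_conv {n : ℕ} {K : EuclideanSpace ℝ (Fin n) → ℝ} (hK : Integrable K)
    (f : State n) : Measurable (conv K f) := by
  have hf := aemeasurable_fn f
  have hK' := hK.1.aemeasurable
  have key : conv K f = fun x => ∫ y, hK'.mk K (x - y) * hf.mk _ y := by
    funext x
    refine integral_congr_ae ?_
    have h1 : ∀ᵐ y, K (x - y) = hK'.mk K (x - y) :=
      (quasiMeasurePreserving_sub_left volume x).ae hK'.ae_eq_mk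
    filter_upwards [h1, hf.ae_eq_mk] with y h2 h3
    rw [h2, h3]
  rw [key]
  refine StronglyMeasurable.measurable (StronglyMeasurable.integral_prod_right' (f := fun p :
    EuclideanSpace ℝ (Fin n) × EuclideanSpace ℝ (Fin n) =>
      hK'.mk K (p.1 - p.2) * hf.mk _ p.2) ?_)
  exact ((hK'.measurable_mk.comp (measurable_fst.sub measurable_snd)).mul
    (hf.measurable_mk.comp measurable_snd)).stronglyMeasurable

theorem nullMeasurable_step {n : ℕ} {K : EuclideanSpace ℝ (Fin n) → ℝ} (hK : Integrable K)
    {G : ℝ → ℝ} (hG : Continuous G) (f : State n) (t : I) :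
    NullMeasurable (fun x => (Set.projIcc 0 1 zero_le_one
      ((f.fn x : ℝ) + (t : ℝ) * G (conv K f x)) : I)) volume := by
  have h : AEMeasurable (fun x => (f.fn x : ℝ) + (t : ℝ) * G (conv K f x)) volume :=
    (aemeasurable_fn f).add
      ((hG.measurable.comp (measurable_conv hK f)).const_mul (t : ℝ)).aemeasurable
  have hp : Measurable (Set.projIcc (0 : ℝ) 1 zero_le_one) := continuous_projIcc.measurable
  exact (hp.comp_aemeasurable h).nullMeasurable

/-- The Lenia arc field `X_t(f)(x) = [f(x) + t G((K ∗ f)(x))]₀¹`, where `[·]₀¹` is the clip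
function, i.e. the projection of `ℝ` onto `[0,1]`. -/
noncomputable def arcField {n : ℕ} (K : EuclideanSpace ℝ (Fin n) → ℝ) (hK : Integrable K)
    (G : ℝ → ℝ) (hG : Continuous G) (f : State n) (t : I) : State n :=
  ⟨UniformFun.ofFun fun x =>
      Set.projIcc 0 1 zero_le_one ((f.fn x : ℝ) + (t : ℝ) * G (conv K f x)),
    nullMeasurable_step hK hG f t⟩

/-- The set `C(ℝⁿ, [0,1])` of continuous states. -/
def continuousStates (n : ℕ) : Set (State n) := {f | Continuous f.fn}

end Lenia

/-! The argument is Euler's method in a complete metric space. Three estimates drive it, collected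
in `IsRegular`: a step of length t is Lipschitz with constant 1 + Λt, a step of length s + t differs
from two successive steps by at most Ωst, and X is B-Lipschitz in time. Splitting one step of length
τ into equal parts then costs O(τ²). Summed over n steps of length t/n and propagated with factor
exp(Λt), this gives an O(1/n) error (`dist_euler_refine_le`), so Euler curves are Cauchy. The same
estimates make the limit a flow tangent to X, and Grönwall makes it unique.

For Lenia, Young's inequality and the Lipschitz bound on G give Λ = L‖K‖₁. Clipping causes no defect
by itself (`projIcc_projIcc_add`); only the change of K ∗ f during the first step does, so Ω = ΛB.
Continuity persists because the continuous states are invariant under X and closed under uniform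
limits. -/

namespace Lenia

/-! ### Regular arc fields: Euler curves, flow, uniqueness -/

section AbstractArcFields

variable {M : Type*}

/-- The time-`h` map of an arc field, with `h` clipped to `[0,1]`. -/
noncomputable def stepMap (X : M → I → M) (h : ℝ) (f : M) : M := X f (Set.projIcc 0 1 zero_le_one h)

theorem euler_eq_iterate (X : M → I → M) (t : ℝ≥0) (n : ℕ) (f : M) :
    euler X t n f = (stepMap X ((t : ℝ) / n))^[n] f := rfl

theorem stepMap_coe (X : M → I → M) (t : I) (f : M) : stepMap X t f = X f t := by
  simp [stepMap]

variable [MetricSpace M]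

/-- Quantitative conditions on an arc field under which its Euler curves converge. -/
structure IsRegular (X : M → I → M) (Λ Ω B : ℝ) : Prop where
  nonneg_growth : 0 ≤ Λ
  nonneg_defect : 0 ≤ Ω
  nonneg_speed : 0 ≤ B
  zero : ∀ f, stepMap X 0 f = f
  growth : ∀ f g t, 0 ≤ t → t ≤ 1 →
    dist (stepMap X t f) (stepMap X t g) ≤ (1 + Λ * t) * dist f g
  defect : ∀ f s t, 0 ≤ s → 0 ≤ t → s + t ≤ 1 →
    dist (stepMap X (s + t) f) (stepMap X t (stepMap X s f)) ≤ Ω * (s * t)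
  speed : ∀ f s t, dist (stepMap X s f) (stepMap X t f) ≤ B * |s - t|

namespace IsRegular

variable {X : M → I → M} {Λ Ω B : ℝ}

/-- Discrete Grönwall: each iteration adds at most B|a - b| from the step mismatch and multiplies
the old distance by 1 + Λb ≤ exp(Λb). -/
theorem dist_iterate_le (hX : IsRegular X Λ Ω B) {a b : ℝ} (hb : 0 ≤ b) (hb1 : b ≤ 1)
    (m : ℕ) (f g : M) :
    dist ((stepMap X a)^[m] f) ((stepMap X b)^[m] g) ≤
      Real.exp (Λ * (m * b)) * (dist f g + m * (B * |a - b|)) := by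
  have hΛ := hX.nonneg_growth
  have hB := hX.nonneg_speed
  induction m with
  | zero => simp
  | succ m ih =>
    rw [Function.iterate_succ_apply', Function.iterate_succ_apply']
    set u := (stepMap X a)^[m] f
    set v := (stepMap X b)^[m] g
    have h1 := dist_triangle (stepMap X a u) (stepMap X b u) (stepMap X b v)
    have h2 := hX.speed u a b
    have h3 := hX.growth u v b hb hb1
    have h4 : 1 + Λ * b ≤ Real.exp (Λ * b) := by linarith [Real.add_one_le_exp (Λ * b)]
    have h5 : Real.exp (Λ * ((m + 1 : ℕ) * b)) = Real.exp (Λ * b) * Real.exp (Λ * (m * b)) := by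
      rw [← Real.exp_add]; push_cast; ring_nf
    have h6 : 1 ≤ Real.exp (Λ * ((m + 1 : ℕ) * b)) := Real.one_le_exp (by positivity)
    have h7 : (1 + Λ * b) * dist u v ≤ Real.exp (Λ * ((m + 1 : ℕ) * b)) *
        (dist f g + m * (B * |a - b|)) := by
      rw [h5, mul_assoc]
      exact mul_le_mul h4 ih dist_nonneg (Real.exp_pos _).le
    have h8 : B * |a - b| ≤ Real.exp (Λ * ((m + 1 : ℕ) * b)) * (B * |a - b|) :=
      le_mul_of_one_le_left (by positivity) h6
    calc dist (stepMap X a u) (stepMap X b v)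
        ≤ Real.exp (Λ * ((m + 1 : ℕ) * b)) * (B * |a - b|) +
          Real.exp (Λ * ((m + 1 : ℕ) * b)) * (dist f g + m * (B * |a - b|)) := by linarith
      _ = _ := by push_cast; ring

theorem dist_iterate_same_le (hX : IsRegular X Λ Ω B) {h : ℝ} (h0 : 0 ≤ h) (h1 : h ≤ 1)
    (m : ℕ) (f g : M) :
    dist ((stepMap X h)^[m] f) ((stepMap X h)^[m] g) ≤ Real.exp (Λ * (m * h)) * dist f g := by
  simpa using hX.dist_iterate_le h0 h1 m f g (a := h)

/-- Splitting off the i-th small step costs a defect Ω(ih)h; these add up to at most Ω(mh)²,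
amplified by the Lipschitz factors. -/
theorem dist_step_iterate_le (hX : IsRegular X Λ Ω B) {h : ℝ} (h0 : 0 ≤ h) (m : ℕ)
    (hm : m * h ≤ 1) (f : M) :
    dist (stepMap X (m * h) f) ((stepMap X h)^[m] f) ≤
      Ω * (m * h) ^ 2 * Real.exp (Λ * (m * h)) := by
  have hΛ := hX.nonneg_growth
  have hΩ := hX.nonneg_defect
  induction m with
  | zero => simp [hX.zero]
  | succ m ih =>
    rw [Function.iterate_succ_apply']
    push_cast at hm ⊢
    have hmh : 0 ≤ m * h := by positivity
    have ih := ih (by linarith)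
    rw [add_one_mul] at hm ⊢
    set u := stepMap X (m * h) f
    set v := (stepMap X h)^[m] f
    have h1 := dist_triangle (stepMap X (m * h + h) f) (stepMap X h u) (stepMap X h v)
    have h2 := hX.defect f (m * h) h hmh h0 hm
    have h3 := hX.growth u v h h0 (by linarith)
    have h4 : 1 + Λ * h ≤ Real.exp (Λ * h) := by linarith [Real.add_one_le_exp (Λ * h)]
    have h5 : Real.exp (Λ * (m * h + h)) = Real.exp (Λ * h) * Real.exp (Λ * (m * h)) := by
      rw [← Real.exp_add]; ring_nf
    have h6 : 1 ≤ Real.exp (Λ * (m * h + h)) := Real.one_le_exp (by positivity)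
    have h7 : (1 + Λ * h) * dist u v ≤ Real.exp (Λ * (m * h + h)) * (Ω * (m * h) ^ 2) := by
      rw [h5, mul_assoc, mul_comm (Real.exp (Λ * (m * h)))]
      exact mul_le_mul h4 ih dist_nonneg (Real.exp_pos _).le
    have h8 : Ω * (m * h * h) ≤ Real.exp (Λ * (m * h + h)) * (Ω * (m * h * h)) :=
      le_mul_of_one_le_left (by positivity) h6
    have h9 : Ω * (m * h * h) + Ω * (m * h) ^ 2 ≤ Ω * (m * h + h) ^ 2 := by
      have : 0 ≤ Ω * (m * h * h + h ^ 2) := by positivity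
      linarith
    have h10 := mul_le_mul_of_nonneg_left h9 (Real.exp_pos (Λ * (m * h + h))).le
    calc dist (stepMap X (m * h + h) f) (stepMap X h v)
        ≤ Real.exp (Λ * (m * h + h)) * (Ω * (m * h * h) + Ω * (m * h) ^ 2) := by linarith
      _ ≤ _ := by rw [mul_comm (Ω * _)]; exact h10

/-- The first coarse step is peeled off; its local error is carried along by the remaining fine
steps. -/
theorem dist_iterate_refine_le (hX : IsRegular X Λ Ω B) {h : ℝ} (h0 : 0 ≤ h) {m : ℕ}
    (hm0 : m ≠ 0) (hm : m * h ≤ 1) (N : ℕ) (f : M) :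
    dist ((stepMap X (m * h))^[N] f) ((stepMap X h)^[m * N] f) ≤
      N * (Ω * (m * h) ^ 2) * Real.exp (Λ * (N * (m * h))) := by
  have hΛ := hX.nonneg_growth
  have hΩ := hX.nonneg_defect
  have h1 : h ≤ 1 := by
    refine le_trans (le_mul_of_one_le_left h0 ?_) hm
    exact_mod_cast Nat.one_le_iff_ne_zero.2 hm0
  induction N generalizing f with
  | zero => simp
  | succ N ih =>
    rw [Function.iterate_succ_apply, mul_add_one, Function.iterate_add_apply]
    set u := stepMap X (m * h) f
    set v := (stepMap X h)^[m] f
    have a1 := dist_triangle ((stepMap X (m * h))^[N] u) ((stepMap X h)^[m * N] u)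
      ((stepMap X h)^[m * N] v)
    have a2 := ih u
    have a3 := hX.dist_iterate_same_le h0 h1 (m * N) u v
    have a4 := hX.dist_step_iterate_le h0 m hm f
    push_cast at a3 ⊢
    have e1 : Real.exp (Λ * ((N + 1) * (m * h))) =
        Real.exp (Λ * (N * (m * h))) * Real.exp (Λ * (m * h)) := by
      rw [← Real.exp_add]; ring_nf
    have e2 : (m * N * h : ℝ) = N * (m * h) := by ring
    rw [e2] at a3
    have a5 := mul_le_mul_of_nonneg_left a4 (Real.exp_pos (Λ * (N * (m * h)))).le
    have a6 : N * (Ω * (m * h) ^ 2) * Real.exp (Λ * (N * (m * h))) ≤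
        N * (Ω * (m * h) ^ 2) * Real.exp (Λ * ((N + 1) * (m * h))) := by
      gcongr; linarith
    calc _ ≤ N * (Ω * (m * h) ^ 2) * Real.exp (Λ * ((N + 1) * (m * h))) +
          Real.exp (Λ * (N * (m * h))) * (Ω * (m * h) ^ 2 * Real.exp (Λ * (m * h))) := by
            linarith
      _ = _ := by rw [e1]; ring

theorem dist_euler_refine_le (hX : IsRegular X Λ Ω B) {t : ℝ≥0} {n j : ℕ} (hn : n ≠ 0)
    (hj : j ≠ 0) (ht : (t : ℝ) ≤ n) (f : M) :
    dist (euler X t n f) (euler X t (n * j) f) ≤ Ω * t ^ 2 * Real.exp (Λ * t) / n := by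
  have hn' : (0 : ℝ) < n := by positivity
  have hj' : (j : ℝ) ≠ 0 := by positivity
  have e : (j : ℝ) * (t / ((n * j : ℕ) : ℝ)) = t / n := by push_cast; field_simp
  have := hX.dist_iterate_refine_le (h := (t : ℝ) / ((n * j : ℕ) : ℝ)) (by positivity) hj
    (by rw [e, div_le_one hn']; exact ht) n f
  rw [e, mul_comm j n] at this
  rw [euler_eq_iterate, euler_eq_iterate]
  refine this.trans_eq ?_
  rw [mul_div_cancel₀ _ hn'.ne']
  field_simp

theorem cauchySeq_euler (hX : IsRegular X Λ Ω B) (t : ℝ≥0) (f : M) :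
    CauchySeq (fun n => euler X t n f) := by
  set C := Ω * t ^ 2 * Real.exp (Λ * t)
  have hC : Tendsto (fun n : ℕ => C / n) atTop (𝓝 0) := tendsto_const_div_atTop_nhds_zero_nat C
  rw [Metric.cauchySeq_iff]
  intro ε hε
  obtain ⟨N, hN⟩ := eventually_atTop.1 ((hC.eventually_lt_const (half_pos hε)).and
    ((tendsto_natCast_atTop_atTop.eventually_ge_atTop (t : ℝ)).and (eventually_ne_atTop 0)))
  refine ⟨N, fun m hm n hn => ?_⟩
  obtain ⟨a1, a2, a3⟩ := hN m hm
  obtain ⟨b1, b2, b3⟩ := hN n hn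
  -- Both approximations are compared with their common refinement into m * n steps.
  have h1 := hX.dist_euler_refine_le a3 b3 a2 f
  have h2 := hX.dist_euler_refine_le b3 a3 b2 f
  rw [mul_comm n m] at h2
  have h3 := dist_triangle_right (euler X t m f) (euler X t n f) (euler X t (m * n) f)
  linarith

/-! ### The limit of the Euler curves is a flow -/

section Limit

variable {F : M → ℝ≥0 → M}

theorem dist_euler_limit_le (hX : IsRegular X Λ Ω B)
    (hF : ∀ f t, Tendsto (fun k => euler X t k f) atTop (𝓝 (F f t))) {t : ℝ≥0} {n : ℕ}
    (hn : n ≠ 0) (ht : (t : ℝ) ≤ n) (f : M) :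
    dist (euler X t n f) (F f t) ≤ Ω * t ^ 2 * Real.exp (Λ * t) / n := by
  have h1 : Tendsto (fun j : ℕ => n * j) atTop atTop :=
    tendsto_id.const_mul_atTop' (Nat.pos_of_ne_zero hn)
  refine le_of_tendsto (tendsto_const_nhds.dist ((hF f t).comp h1)) ?_
  filter_upwards [eventually_ne_atTop 0] with j hj
  exact hX.dist_euler_refine_le hn hj ht f

/-- Limit of `dist_iterate_le` with a = s/k and b = t/k, where k|a - b| = |s - t|. The exponential
involves only t, so it is constant when (g, t) is fixed, as in the continuity proof. -/
theorem dist_limit_le (hX : IsRegular X Λ Ω B)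
    (hF : ∀ f t, Tendsto (fun k => euler X t k f) atTop (𝓝 (F f t))) (f g : M) (s t : ℝ≥0) :
    dist (F f s) (F g t) ≤ Real.exp (Λ * t) * (dist f g + B * |(s : ℝ) - t|) := by
  refine le_of_tendsto ((hF f s).dist (hF g t)) ?_
  filter_upwards [tendsto_natCast_atTop_atTop.eventually_ge_atTop (t : ℝ),
    eventually_ne_atTop 0] with k hk hk0
  have hk' : (0 : ℝ) < k := by positivity
  have := hX.dist_iterate_le (a := s / k) (b := t / k) (by positivity)
    ((div_le_one hk').2 hk) k f g
  rw [← sub_div, abs_div, abs_of_pos hk', mul_div_cancel₀ _ hk'.ne'] at this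
  rw [euler_eq_iterate, euler_eq_iterate]
  refine this.trans_eq ?_
  field_simp

theorem continuous_limit (hX : IsRegular X Λ Ω B)
    (hF : ∀ f t, Tendsto (fun k => euler X t k f) atTop (𝓝 (F f t))) :
    Continuous (fun p : M × ℝ≥0 => F p.1 p.2) := by
  refine continuous_iff_continuousAt.2 fun ⟨f, s⟩ => tendsto_iff_dist_tendsto_zero.2 ?_
  refine squeeze_zero (fun _ => dist_nonneg) (fun p => hX.dist_limit_le hF p.1 f p.2 s) ?_
  have h : Continuous (fun p : M × ℝ≥0 =>
      Real.exp (Λ * s) * (dist p.1 f + B * |(p.2 : ℝ) - s|)) := by fun_prop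
  simpa using h.tendsto (f, s)

/-- Taking m k steps of length 1/k is the Euler approximation at time (m k)/k with m k steps, so the
error bound and the continuity of F apply. -/
theorem tendsto_iterate_floor (hX : IsRegular X Λ Ω B)
    (hF : ∀ f t, Tendsto (fun k => euler X t k f) atTop (𝓝 (F f t))) (f : M) (m : ℕ → ℕ)
    (t : ℝ≥0) (hm : Tendsto (fun k : ℕ => (m k : ℝ≥0) / k) atTop (𝓝 t)) :
    Tendsto (fun k : ℕ => (stepMap X (1 / k))^[m k] f) atTop (𝓝 (F f t)) := by
  have hc : Tendsto (fun k : ℕ => F f ((m k : ℝ≥0) / k)) atTop (𝓝 (F f t)) :=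
    ((hX.continuous_limit hF).tendsto (f, t)).comp (tendsto_const_nhds.prodMk_nhds hm)
  refine (tendsto_iff_of_dist ?_).2 hc
  have hm' : Tendsto (fun k : ℕ => (((m k : ℝ≥0) / k : ℝ≥0) : ℝ)) atTop (𝓝 t) :=
    (NNReal.continuous_coe.tendsto _).comp hm
  have hlim : Tendsto (fun k : ℕ => Ω * (((m k : ℝ≥0) / k : ℝ≥0) : ℝ) *
      Real.exp (Λ * (((m k : ℝ≥0) / k : ℝ≥0) : ℝ)) * (1 / k : ℝ)) atTop (𝓝 0) := by
    have := ((hm'.const_mul Ω).mul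
      ((Real.continuous_exp.tendsto _).comp (hm'.const_mul Λ))).mul
        tendsto_one_div_atTop_nhds_zero_nat
    simpa using this
  refine squeeze_zero' (Eventually.of_forall fun _ => dist_nonneg) ?_ hlim
  filter_upwards [eventually_ne_atTop 0] with k hk
  have hk' : (0 : ℝ) < k := by positivity
  -- With no steps the error bound would divide by zero; here both sides equal f.
  by_cases h0 : m k = 0
  · have : F f 0 = f := by
      refine tendsto_nhds_unique (hF f 0) (tendsto_const_nhds.congr fun n => ?_)
      rw [euler_eq_iterate, NNReal.coe_zero, zero_div]
      exact (Function.iterate_fixed (hX.zero f) n).symm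
    simp [h0, this]
  · have hm0 : (0 : ℝ) < m k := by positivity
    have := hX.dist_euler_limit_le hF (t := (m k : ℝ≥0) / k) (n := m k) h0 (by
      push_cast
      exact div_le_self hm0.le (by exact_mod_cast Nat.one_le_iff_ne_zero.2 hk)) f
    have e : (((m k : ℝ≥0) / k : ℝ≥0) : ℝ) / m k = 1 / k := by
      push_cast; field_simp
    rw [euler_eq_iterate, e] at this
    refine this.trans_eq ?_
    push_cast
    field_simp

/-- On the common grid of mesh 1/k, times s and t are rounded down separately, so iterates compose
exactly even for incommensurable s and t. -/
theorem limit_add (hX : IsRegular X Λ Ω B)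
    (hF : ∀ f t, Tendsto (fun k => euler X t k f) atTop (𝓝 (F f t))) (f : M) (s t : ℝ≥0) :
    F (F f s) t = F f (s + t) := by
  have hfl : ∀ u : ℝ≥0, Tendsto (fun k : ℕ => ((⌊(u : ℝ) * k⌋₊ : ℕ) : ℝ≥0) / k) atTop (𝓝 u) :=
    fun u => NNReal.tendsto_coe.1 <| by
      simpa [Function.comp_def] using
        (tendsto_nat_floor_mul_div_atTop u.2).comp tendsto_natCast_atTop_atTop
  have h1 := hX.tendsto_iterate_floor hF f (fun k : ℕ => ⌊(t : ℝ) * k⌋₊ + ⌊(s : ℝ) * k⌋₊) (s + t) (by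
    have := (hfl t).add (hfl s)
    rw [add_comm s t]
    refine this.congr fun k => ?_
    push_cast
    rw [add_div])
  have h2 := hX.tendsto_iterate_floor hF (F f s) (fun k : ℕ => ⌊(t : ℝ) * k⌋₊) t (hfl t)
  have h3 := hX.tendsto_iterate_floor hF f (fun k : ℕ => ⌊(s : ℝ) * k⌋₊) s (hfl s)
  refine tendsto_nhds_unique ((tendsto_iff_of_dist ?_).2 h2) h1
  have hd : Tendsto (fun k : ℕ => Real.exp (Λ * t) *
      dist ((stepMap X (1 / k))^[⌊(s : ℝ) * k⌋₊] f) (F f s)) atTop (𝓝 0) := by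
    simpa using (tendsto_iff_dist_tendsto_zero.1 h3).const_mul (Real.exp (Λ * t))
  refine squeeze_zero' (Eventually.of_forall fun _ => dist_nonneg) ?_ hd
  filter_upwards [eventually_ne_atTop 0] with k hk
  have hk' : (1 : ℝ) ≤ k := by exact_mod_cast Nat.one_le_iff_ne_zero.2 hk
  simp only [Function.iterate_add_apply]
  refine (hX.dist_iterate_same_le (by positivity) (by rw [div_le_one] <;> linarith) _ _ _).trans ?_
  have hΛ := hX.nonneg_growth
  gcongr
  rw [mul_one_div, div_le_iff₀ (by linarith)]
  exact Nat.floor_le (by positivity)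

/-- The Euler error bound with a single step; being quadratic in h, it yields tangency. -/
theorem dist_limit_step_le (hX : IsRegular X Λ Ω B)
    (hF : ∀ f t, Tendsto (fun k => euler X t k f) atTop (𝓝 (F f t))) (f : M) (h : I) :
    dist (F f (unitInterval.toNNReal h)) (X f h) ≤ Ω * (h : ℝ) ^ 2 * Real.exp Λ := by
  have hΛ := hX.nonneg_growth
  have hΩ := hX.nonneg_defect
  have h1 : ((unitInterval.toNNReal h : ℝ≥0) : ℝ) = h := rfl
  have := hX.dist_euler_limit_le hF (t := unitInterval.toNNReal h) (n := 1) one_ne_zero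
    (by rw [h1]; simpa using h.2.2) f
  rw [euler_eq_iterate, h1, Function.iterate_one, Nat.cast_one, div_one, div_one, stepMap_coe,
    dist_comm] at this
  refine this.trans ?_
  gcongr
  exact mul_le_of_le_one_right hΛ h.2.2

theorem isFlowOf_limit (hX : IsRegular X Λ Ω B)
    (hF : ∀ f t, Tendsto (fun k => euler X t k f) atTop (𝓝 (F f t))) : IsFlowOf X F where
  continuous := hX.continuous_limit hF
  zero f := by
    have := hX.dist_limit_step_le hF f 0
    have e : X f 0 = f := by simpa [← stepMap_coe] using hX.zero f
    rw [e] at this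
    simpa using this
  add := hX.limit_add hF
  tangent f t := by
    have hc : Continuous fun h : I => Ω * (h : ℝ) * Real.exp Λ := by fun_prop
    have h0 : Tendsto (fun h : I => Ω * (h : ℝ) * Real.exp Λ) (𝓝[>] 0) (𝓝 0) := by
      simpa using (hc.tendsto 0).mono_left nhdsWithin_le_nhds
    refine squeeze_zero' (Eventually.of_forall fun h => div_nonneg dist_nonneg h.2.1) ?_ h0
    filter_upwards [self_mem_nhdsWithin] with h hh
    have hh' : (0 : ℝ) < h := hh
    rw [div_le_iff₀ hh', ← hX.limit_add hF]
    refine (hX.dist_limit_step_le hF (F f t) h).trans_eq ?_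
    ring

end Limit

theorem isArcField (hX : IsRegular X Λ Ω B) : IsArcField X where
  zero f := by simpa [← stepMap_coe] using hX.zero f
  continuous := by
    refine continuous_iff_continuousAt.2 fun ⟨f, s⟩ => tendsto_iff_dist_tendsto_zero.2 ?_
    refine squeeze_zero (g := fun p : M × I => B * |(p.2 : ℝ) - s| + (1 + Λ * s) * dist p.1 f)
      (fun _ => dist_nonneg) (fun p => ?_) ?_
    · have h1 := hX.speed p.1 p.2 s
      have h2 := hX.growth p.1 f s s.2.1 s.2.2
      simp only [stepMap_coe] at h1 h2
      exact (dist_triangle _ (X p.1 s) _).trans (add_le_add h1 h2)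
    · have h : Continuous (fun p : M × I =>
          B * |(p.2 : ℝ) - s| + (1 + Λ * s) * dist p.1 f) := by fun_prop
      simpa using h.tendsto (f, s)

end IsRegular

/-- Tangency restated for real increments, as needed in the Grönwall argument. -/
theorem IsFlowOf.eventually_dist_le {X : M → I → M} {F : M → ℝ≥0 → M} (hF : IsFlowOf X F)
    (f : M) (t : ℝ≥0) {ε : ℝ} (hε : 0 < ε) :
    ∀ᶠ h in 𝓝[>] (0 : ℝ), dist (F f (t + h.toNNReal)) (stepMap X h (F f t)) ≤ ε * h := by
  have hp : Tendsto (Set.projIcc (0 : ℝ) 1 zero_le_one) (𝓝[>] 0) (𝓝[>] 0) := by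
    refine tendsto_nhdsWithin_iff.2 ⟨?_, ?_⟩
    · refine (continuous_projIcc.tendsto' _ _ ?_).mono_left nhdsWithin_le_nhds
      exact Set.projIcc_left _
    · filter_upwards [self_mem_nhdsWithin] with h hh
      have hh' : (0 : ℝ) < h := hh
      change (0 : ℝ) < (Set.projIcc (0 : ℝ) 1 zero_le_one h : ℝ)
      simp [Set.coe_projIcc, hh']
  have h1 : Set.Ioo (0 : ℝ) 1 ∈ 𝓝[>] (0 : ℝ) := Ioo_mem_nhdsGT one_pos
  filter_upwards [hp.eventually ((hF.tangent f t).eventually_lt_const hε), h1] with h hh hh1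
  have e : ((Set.projIcc (0 : ℝ) 1 zero_le_one h : I) : ℝ) = h := by
    simp [Set.coe_projIcc, hh1.1.le, hh1.2.le]
  have e2 : unitInterval.toNNReal (Set.projIcc (0 : ℝ) 1 zero_le_one h) = h.toNNReal := by
    refine NNReal.coe_injective ?_
    rw [Real.coe_toNNReal _ hh1.1.le]
    exact e
  rw [e, e2, div_lt_iff₀ hh1.1] at hh
  exact hh.le

/-- The distance φ between two flow lines starts at 0 and its right difference quotients are
asymptotically at most Λφ, so Grönwall forces φ = 0. -/
theorem IsRegular.flow_unique {X : M → I → M} {Λ Ω B : ℝ} (hX : IsRegular X Λ Ω B)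
    {F F' : M → ℝ≥0 → M} (hF : IsFlowOf X F) (hF' : IsFlowOf X F') : F' = F := by
  funext f T
  have hcont : Continuous fun x : ℝ => dist (F' f x.toNNReal) (F f x.toNNReal) :=
    (hF'.continuous.comp (continuous_const.prodMk continuous_real_toNNReal)).dist
      (hF.continuous.comp (continuous_const.prodMk continuous_real_toNNReal))
  have key := le_gronwallBound_of_liminf_deriv_right_le (δ := 0) (K := Λ) (ε := 0) (a := 0)
    (b := T) (f' := fun x => Λ * dist (F' f x.toNNReal) (F f x.toNNReal))
    hcont.continuousOn (fun x hx r hr => ?_) (by simp [hF.zero, hF'.zero]) (fun x _ => by simp)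
    T ⟨T.2, le_rfl⟩
  · rw [gronwallBound_ε0_δ0] at key
    simpa using key
  · refine Eventually.frequently ?_
    set u := F' f x.toNNReal
    set v := F f x.toNNReal
    -- Each tangency error uses one third of the gap; the last third keeps the inequality strict.
    have hε : 0 < (r - Λ * dist u v) / 3 := by linarith
    have hsub : Tendsto (fun z : ℝ => z - x) (𝓝[>] x) (𝓝[>] 0) := by
      refine tendsto_nhdsWithin_iff.2 ⟨?_, ?_⟩
      · have : Continuous fun z : ℝ => z - x := by fun_prop
        exact (this.tendsto' _ _ (sub_self x)).mono_left nhdsWithin_le_nhds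
      · filter_upwards [self_mem_nhdsWithin] with z hz
        exact sub_pos.2 (Set.mem_Ioi.1 hz)
    have h1 : Set.Ioo (0 : ℝ) 1 ∈ 𝓝[>] (0 : ℝ) := Ioo_mem_nhdsGT one_pos
    filter_upwards [hsub.eventually (hF.eventually_dist_le f x.toNNReal hε),
      hsub.eventually (hF'.eventually_dist_le f x.toNNReal hε), hsub h1] with z a1 a2 a3
    have a3' : 0 < z - x ∧ z - x < 1 := a3
    have e : x.toNNReal + (z - x).toNNReal = z.toNNReal := by
      rw [← Real.toNNReal_add hx.1 a3'.1.le, add_sub_cancel]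
    rw [e] at a1 a2
    have a4 := hX.growth u v (z - x) a3'.1.le a3'.2.le
    have a5 := dist_triangle4 (F' f z.toNNReal) (stepMap X (z - x) u) (stepMap X (z - x) v)
      (F f z.toNNReal)
    rw [dist_comm (stepMap X (z - x) v)] at a5
    rw [inv_mul_lt_iff₀ a3'.1]
    have a6 := mul_pos a3'.1 hε
    linarith

/-- A regular arc field on a complete metric space has a unique flow, the limit of its Euler
curves. -/
theorem IsRegular.exists_flow [CompleteSpace M] {X : M → I → M} {Λ Ω B : ℝ}
    (hX : IsRegular X Λ Ω B) :
    ∃ F : M → ℝ≥0 → M, IsFlowOf X F ∧ (∀ F', IsFlowOf X F' → F' = F) ∧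
      ∀ f t, Tendsto (fun k => euler X t k f) atTop (𝓝 (F f t)) := by
  choose F hF using fun f t => cauchySeq_tendsto_of_complete (hX.cauchySeq_euler t f)
  have h := hX.isFlowOf_limit hF
  exact ⟨F, h, fun F' hF' => hX.flow_unique h hF', hF⟩

end AbstractArcFields

end Lenia

namespace Lenia

/-! ### Completeness of the state space and closedness of the continuous states -/

section State

variable {n : ℕ}

theorem State.dist_le {f g : State n} {C : ℝ} (hC : 0 ≤ C) :
    dist f g ≤ C ↔ ∀ x, |(f.fn x : ℝ) - g.fn x| ≤ C :=
  UniformFun.dist_le (f := f.1) (g := g.1) hC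

theorem State.abs_sub_le_dist (f g : State n) (x : EuclideanSpace ℝ (Fin n)) :
    |(f.fn x : ℝ) - g.fn x| ≤ dist f g :=
  (State.dist_le dist_nonneg).1 le_rfl x

theorem State.abs_fn_le_one (f : State n) (x : EuclideanSpace ℝ (Fin n)) :
    |(f.fn x : ℝ)| ≤ 1 := by
  rw [abs_of_nonneg (f.fn x).2.1]
  exact (f.fn x).2.2

theorem isClosed_setOf_nullMeasurable :
    IsClosed {f : UniformFun (EuclideanSpace ℝ (Fin n)) I |
      NullMeasurable (UniformFun.toFun f) volume} := by
  refine IsSeqClosed.isClosed fun u f hu huf => ?_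
  refine (aemeasurable_of_tendsto_metrizable_ae atTop (fun k => (hu k).aemeasurable)
    (Eventually.of_forall fun x => ?_)).nullMeasurable
  exact ((UniformFun.uniformContinuous_eval I x).continuous.tendsto f).comp huf

instance completeSpace_state : CompleteSpace (State n) :=
  isClosed_setOf_nullMeasurable.completeSpace_coe

theorem isClosed_continuousStates (n : ℕ) : IsClosed (continuousStates n) :=
  (UniformFun.isClosed_setOfPred_continuous
    (α := EuclideanSpace ℝ (Fin n)) (β := I)).preimage continuous_subtype_val

end State

section Clip

/-- Both increments have the sign of g, so a value clipped at an endpoint is only pushed further out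
and stays there. -/
theorem projIcc_projIcc_add {u s t g : ℝ} (hu : u ∈ I) (hs : 0 ≤ s) (ht : 0 ≤ t) :
    Set.projIcc (0 : ℝ) 1 zero_le_one ((Set.projIcc (0 : ℝ) 1 zero_le_one (u + s * g) : ℝ) + t * g)
      = Set.projIcc (0 : ℝ) 1 zero_le_one (u + (s + t) * g) := by
  obtain ⟨h0, h1⟩ := hu
  refine Subtype.ext ?_
  simp only [Set.coe_projIcc]
  rw [add_mul]
  rcases le_total 0 g with hg | hg
  · have hsg := mul_nonneg hs hg
    have htg := mul_nonneg ht hg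
    grind
  · have hsg := mul_nonpos_of_nonneg_of_nonpos hs hg
    have htg := mul_nonpos_of_nonneg_of_nonpos ht hg
    grind

end Clip

/-! ### Estimates for the convolution -/

section Convolution

variable {n : ℕ} {K : EuclideanSpace ℝ (Fin n) → ℝ}

theorem integrable_conv (hK : Integrable K) (f : State n) (x : EuclideanSpace ℝ (Fin n)) :
    Integrable fun y => K (x - y) * (f.fn y : ℝ) :=
  (hK.comp_sub_left x).mul_bdd (c := 1) (aemeasurable_fn f).aestronglyMeasurable
    (Eventually.of_forall f.abs_fn_le_one)

theorem abs_conv_sub_le (hK : Integrable K) (f g : State n) (x : EuclideanSpace ℝ (Fin n)) :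
    |conv K f x - conv K g x| ≤ (∫ y, |K y|) * dist f g := by
  rw [conv, conv, ← integral_sub (integrable_conv hK f x) (integrable_conv hK g x),
    ← integral_sub_left_eq_self (fun y => |K y|) volume x, ← integral_mul_const]
  refine norm_integral_le_of_norm_le (G := ℝ) (((hK.comp_sub_left x).abs).mul_const _)
    (Eventually.of_forall fun y => ?_)
  rw [← mul_sub, norm_mul]
  exact mul_le_mul_of_nonneg_left (f.abs_sub_le_dist g y) (norm_nonneg _)

/-- After a change of variables x occurs only in the continuous factor f, and |K| dominates the
integrand. -/
theorem continuous_conv (hK : Integrable K) {f : State n} (hf : Continuous f.fn) :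
    Continuous (conv K f) := by
  have e : conv K f = fun x => ∫ y, K y * (f.fn (x - y) : ℝ) := by
    funext x
    have := integral_sub_left_eq_self (fun y => K y * (f.fn (x - y) : ℝ)) volume x
    simpa [conv] using this
  rw [e]
  refine continuous_of_dominated (bound := fun y => |K y|) (fun x => ?_)
    (fun x => Eventually.of_forall fun y => ?_) hK.abs (Eventually.of_forall fun y => ?_)
  · have : Continuous fun y => (f.fn (x - y) : ℝ) := by fun_prop
    exact hK.1.mul this.aestronglyMeasurable
  · rw [norm_mul]
    exact mul_le_of_le_one_right (norm_nonneg _) (f.abs_fn_le_one _)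
  · fun_prop

end Convolution

/-! ### Regularity of the Lenia arc field -/

section LeniaArcField

variable {n : ℕ} {K : EuclideanSpace ℝ (Fin n) → ℝ} {G : ℝ → ℝ} {L : ℝ≥0} {B : ℝ}

theorem fn_stepMap (hK : Integrable K) (hG : Continuous G) (f : State n) {t : ℝ} (h0 : 0 ≤ t)
    (h1 : t ≤ 1) (x : EuclideanSpace ℝ (Fin n)) :
    (stepMap (arcField K hK G hG) t f).fn x =
      Set.projIcc (0 : ℝ) 1 zero_le_one (f.fn x + t * G (conv K f x)) := by
  have e : ((Set.projIcc (0 : ℝ) 1 zero_le_one t : I) : ℝ) = t := by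
    simp [Set.coe_projIcc, h0, h1]
  change Set.projIcc (0 : ℝ) 1 zero_le_one (f.fn x +
    ((Set.projIcc (0 : ℝ) 1 zero_le_one t : I) : ℝ) * G (conv K f x)) = _
  rw [e]

theorem dist_stepMap_le (hK : Integrable K) (hG : Continuous G) (hB : ∀ u, |G u| ≤ B)
    (f : State n) (s t : ℝ) :
    dist (stepMap (arcField K hK G hG) s f) (stepMap (arcField K hK G hG) t f) ≤
      B * |s - t| := by
  have hB0 : 0 ≤ B := (abs_nonneg _).trans (hB 0)
  refine (State.dist_le (by positivity)).2 fun x => ?_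
  refine (Set.abs_projIcc_sub_projIcc zero_le_one).trans ?_
  rw [add_sub_add_left_eq_sub, ← sub_mul, abs_mul, mul_comm]
  exact mul_le_mul (hB _) (Set.abs_projIcc_sub_projIcc zero_le_one) (abs_nonneg _) hB0

theorem abs_reaction_sub_le (hK : Integrable K) (hG : LipschitzWith L G) (f g : State n)
    (x : EuclideanSpace ℝ (Fin n)) :
    |G (conv K f x) - G (conv K g x)| ≤ L * (∫ y, |K y|) * dist f g := by
  refine (hG.dist_le_mul _ _).trans ?_
  rw [mul_assoc]
  exact mul_le_mul_of_nonneg_left (abs_conv_sub_le hK f g x) L.2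

theorem stepMap_zero (hK : Integrable K) (hG : Continuous G) (f : State n) :
    stepMap (arcField K hK G hG) 0 f = f := by
  refine Subtype.ext (UniformFun.toFun.injective (funext fun x => ?_))
  refine (fn_stepMap hK hG f le_rfl zero_le_one x).trans ?_
  rw [zero_mul, add_zero]
  exact Set.projIcc_val zero_le_one (f.fn x)

theorem isRegular_arcField (hK : Integrable K) (hB : ∀ u, |G u| ≤ B) (hG : LipschitzWith L G) :
    IsRegular (arcField K hK G hG.continuous) (L * ∫ y, |K y|) (L * (∫ y, |K y|) * B) B := by
  have hB0 : 0 ≤ B := (abs_nonneg _).trans (hB 0)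
  have hI : 0 ≤ ∫ y, |K y| := integral_nonneg fun y => abs_nonneg _
  refine ⟨by positivity, by positivity, hB0, stepMap_zero hK hG.continuous, ?_, ?_,
    dist_stepMap_le hK hG.continuous hB⟩
  · intro f g t h0 h1
    refine (State.dist_le (by positivity)).2 fun x => ?_
    rw [fn_stepMap hK _ f h0 h1, fn_stepMap hK _ g h0 h1]
    refine (Set.abs_projIcc_sub_projIcc zero_le_one).trans ?_
    rw [add_sub_add_comm, ← mul_sub]
    refine (abs_add_le _ _).trans ?_
    rw [abs_mul, abs_of_nonneg h0]
    have h2 := f.abs_sub_le_dist g x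
    have h3 := mul_le_mul_of_nonneg_left (abs_reaction_sub_le hK hG f g x) h0
    linarith
  · intro f s t hs ht hst
    refine (State.dist_le (by positivity)).2 fun x => ?_
    -- The long step becomes two clipped steps, both driven by G(K ∗ f). It then differs from the
    -- composition only in the reaction used in the second step.
    rw [fn_stepMap hK _ f (add_nonneg hs ht) hst, fn_stepMap hK _ _ ht (by linarith),
      ← projIcc_projIcc_add (f.fn x).2 hs ht, ← fn_stepMap hK hG.continuous f hs (by linarith)]
    refine (Set.abs_projIcc_sub_projIcc zero_le_one).trans ?_
    rw [add_sub_add_left_eq_sub, ← mul_sub, abs_mul, abs_of_nonneg ht]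
    have h1 := abs_reaction_sub_le hK hG f (stepMap (arcField K hK G hG.continuous) s f) x
    have h2 := dist_stepMap_le hK hG.continuous hB f 0 s
    rw [stepMap_zero, zero_sub, abs_neg, abs_of_nonneg hs] at h2
    calc _ ≤ t * (L * (∫ y, |K y|) * (B * s)) := by
          refine mul_le_mul_of_nonneg_left (h1.trans ?_) ht
          gcongr
      _ = _ := by ring

theorem arcField_mem_continuousStates (hK : Integrable K) (hG : Continuous G) {f : State n}
    (hf : f ∈ continuousStates n) (t : I) : arcField K hK G hG f t ∈ continuousStates n := by
  have hf' : Continuous f.fn := hf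
  have hc := continuous_conv hK hf'
  change Continuous fun x =>
    Set.projIcc (0 : ℝ) 1 zero_le_one ((f.fn x : ℝ) + (t : ℝ) * G (conv K f x))
  exact continuous_projIcc.comp (by fun_prop)

theorem IsArcField.restrictsTo {M : Type*} [MetricSpace M] {X : M → I → M} (hX : IsArcField X)
    {C : Set M} (hC : ∀ f ∈ C, ∀ t, X f t ∈ C) : RestrictsTo X C := by
  refine ⟨fun f t => ⟨X f t, hC f f.2 t⟩, ⟨?_, fun f => Subtype.ext (hX.zero f)⟩,
    fun _ _ => rfl⟩
  have := hX.continuous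
  refine Continuous.subtype_mk ?_ _
  exact this.comp ((continuous_subtype_val.comp continuous_fst).prodMk continuous_snd)

theorem euler_mem {M : Type*} {X : M → I → M} {C : Set M} (hC : ∀ f ∈ C, ∀ t, X f t ∈ C)
    (t : ℝ≥0) (k : ℕ) {f : M} (hf : f ∈ C) : euler X t k f ∈ C :=
  Set.MapsTo.iterate (s := C) (fun g hg => hC g hg _) k hf

end LeniaArcField

end Lenia

theorem mainTheorem6 (n : ℕ)
    (K : EuclideanSpace ℝ (Fin n) → ℝ) (hK : MeasureTheory.Integrable K MeasureTheory.volume)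
    (G : ℝ → ℝ) (hGb : ∃ B : ℝ, ∀ u, |G u| ≤ B) (L : ℝ≥0) (hG : LipschitzWith L G) :
    -- the Lenia solutions are well defined: the arc field has exactly one flow `F`,
    -- and `F` is the limit of the Euler curves
    Lenia.IsArcField (Lenia.arcField K hK G hG.continuous) ∧
    (∃ F : Lenia.State n → ℝ≥0 → Lenia.State n,
      Lenia.IsFlowOf (Lenia.arcField K hK G hG.continuous) F ∧
      (∀ F' : Lenia.State n → ℝ≥0 → Lenia.State n,
        Lenia.IsFlowOf (Lenia.arcField K hK G hG.continuous) F' → F' = F) ∧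
      (∀ (f₀ : Lenia.State n) (t : ℝ≥0),
        Filter.Tendsto (fun k : ℕ => Lenia.euler (Lenia.arcField K hK G hG.continuous) t k f₀)
          Filter.atTop (nhds (F f₀ t))) ∧
      -- the solution `F f₀ t` is continuous whenever `f₀` is
      (∀ f₀ : Lenia.State n, Continuous f₀.fn → ∀ t : ℝ≥0, 0 < t → Continuous (F f₀ t).fn)) ∧
    -- the continuous states form a closed subspace, to which the arc field restricts,
    -- and limits of Euler curves stay in it
    IsClosed (Lenia.continuousStates n) ∧
    Lenia.RestrictsTo (Lenia.arcField K hK G hG.continuous) (Lenia.continuousStates n) ∧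
    (∀ f₀ ∈ Lenia.continuousStates n, ∀ (t : ℝ≥0) (g : Lenia.State n),
      Filter.Tendsto (fun k : ℕ => Lenia.euler (Lenia.arcField K hK G hG.continuous) t k f₀)
        Filter.atTop (nhds g) → g ∈ Lenia.continuousStates n) := by
  obtain ⟨B, hB⟩ := hGb
  have hX := Lenia.isRegular_arcField hK hB hG
  have hmaps : ∀ f ∈ Lenia.continuousStates n, ∀ t,
      Lenia.arcField K hK G hG.continuous f t ∈ Lenia.continuousStates n :=
    fun f hf t => Lenia.arcField_mem_continuousStates hK hG.continuous hf t
  -- Euler approximations never leave the invariant set, which is closed; this gives both the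
  -- continuity of solutions and the final claim.
  have hlim : ∀ f₀ ∈ Lenia.continuousStates n, ∀ (t : ℝ≥0) (g : Lenia.State n),
      Tendsto (fun k : ℕ => Lenia.euler (Lenia.arcField K hK G hG.continuous) t k f₀)
        atTop (𝓝 g) → g ∈ Lenia.continuousStates n := fun f₀ hf₀ t g hg =>
    (Lenia.isClosed_continuousStates n).mem_of_tendsto hg
      (Eventually.of_forall fun k => Lenia.euler_mem hmaps t k hf₀)
  obtain ⟨F, hF, huniq, hFlim⟩ := hX.exists_flow
  exact ⟨hX.isArcField, ⟨F, hF, huniq, hFlim, fun f₀ hf₀ t _ => hlim f₀ hf₀ t _ (hFlim f₀ t)⟩,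
    Lenia.isClosed_continuousStates n, hX.isArcField.restrictsTo hmaps, hlim⟩
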